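/- Let $p\ge 1$ and let real parameters $c$, $a_j$, $b_j$ $(j\ge0)$ satisfy $$a_{j+p+1}=a_j+1,\quad b_{j+p}=b_j+1\quad (j\ge 0),\qquad a_0=0,\quad c\ne0,\quad a_j\ne0,\ b_j\neq0\quad (j>0).$$ Consider the Bogoyavlensky lattice $\mathrm{BL}_p$, $$u_j'=u_j(u_{j+p}+\dots+u_{j+1}-u_{j-1}-\dots-u_{j-p}),\qquad j\in\mathbb Z,$$ with the boundary condition $u_j=0$ for $j\le 0$ and the initial data $$u_1(0)=c^{p+1}\frac{a_1\cdots a_p}{b_1\cdots b_p},\qquad u_j(0)=c^{p+1}\frac{(b_{j-1}-a_{j-1})\,a_j\cdots a_{j+p-1}}{b_{j-1}\cdots b_{j+p-1}}\quad (j>1).$$ By a solution on an open interval $I\ni0$ we mean a family of real analytic functions $u_j$ on $I$ satisfying these equations. Define functions $f_j$, $j\ge -p$, analytic on $I$, by $f_{-p}=\dots=f_0=1$, $$f_j(t)={}_pF_p\bigl(a_j,\dots,\widehat{a_{p+1}},\dots,a_{j+p};\ b_j,\dots,b_{j+p-1};\ c^{p+1}t\bigr),\qquad j=1,\dots,p$$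 (the hat denotes omission of the upper parameter $a_{p+1}=1$), and recursively by $$f_{j-1}f_j'-f_{j-1}'f_j=f_{j-p-1}f_{j+p},\qquad j\ge1,\tag{1}$$ where $f_{j+p}$ is set equal to $0$ if $f_{j-p-1}$ vanishes identically, so that (1) does not determine it. (i) The Cauchy problem has a solution on some interval $(-\delta,\delta)$, $\delta>0$, common to all $j$, and on every open interval $I\ni 0$ it has at most one solution. The sequence $(f_j)_{j\ge-p}$ on $I$ is also unique if it exists. (ii) Whenever the solution exists on an open interval $I\ni0$, the functions $f_j$ exist on $I$, and for all $j\ge1$ such that neither $f_{j-1}$ nor $f_j$ vanishes identically on $I$, both are nowhere zero on $I$ and $$u_j=\frac{f_j'}{f_j}-\frac{f_{j-1}'}{f_{j-1}}\qquad\Bigl(\text{in particular } u_1=\frac{f_1'}{f_1}\Bigr).\tag{2}$$ Moreover $f_j$ is nowhere zero on $I$ for every $j\ge1$ such that $a_i\ne b_i$ for all $i$ with $1\le i<j-p$. Thus if $a_i\neq b_i$ for all $i\ge1$, then (1) and (2) give the whole solution. (iii) Conversely, if on an open interval $I\ni 0$ the functions $f_j$ exist and are nowhere zero for all $j\ge1$,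 then the functions $u_j$ defined by (2) for $j\ge 1$ and by $u_j=0$ for $j\le0$ are the solution of the Cauchy problem on $I$. -/

import Mathlib

open scoped Nat

namespace Bogoyavlensky

/-- The generalized hypergeometric series `ₘFₙ(A; B; z) = ∑ ∏_{x ∈ A} (x)_k / ∏_{y ∈ B} (y)_k * z^k / k!`,
where `(x)_k` is the rising factorial and `A`, `B` are the multisets of upper and lower parameters. -/
noncomputable def pFq (A B : Multiset ℝ) (z : ℝ) : ℝ :=
  ∑' k : ℕ, (A.map fun x => (ascPochhammer ℝ k).eval x).prod /
    (B.map fun y => (ascPochhammer ℝ k).eval y).prod * (z ^ k / (k ! : ℝ))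

/-- The family `u` solves the lattice `BL_p`,
`u_j' = u_j (u_{j+p} + ⋯ + u_{j+1} - u_{j-1} - ⋯ - u_{j-p})`, on the set `I`;
every component is real analytic on `I`. -/
structure IsBLSolution (p : ℕ) (I : Set ℝ) (u : ℤ → ℝ → ℝ) : Prop where
  analytic : ∀ j : ℤ, AnalyticOnNhd ℝ (u j) I
  lattice : ∀ j : ℤ, ∀ t ∈ I, HasDerivAt (u j)
    (u j t * (∑ i ∈ Finset.Icc 1 p, u (j + (i : ℤ)) t - ∑ i ∈ Finset.Icc 1 p, u (j - (i : ℤ)) t)) t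

/-- The Cauchy problem on the half-line: `BL_p`, the boundary condition `u_j = 0` for `j ≤ 0`,
and the initial data at `t = 0` given by the parameters `a`, `b`, `c`. -/
structure IsCauchySolution (p : ℕ) (a b : ℕ → ℝ) (c : ℝ) (I : Set ℝ) (u : ℤ → ℝ → ℝ) : Prop
    extends IsBLSolution p I u where
  boundary : ∀ j : ℤ, j ≤ 0 → ∀ t ∈ I, u j t = 0
  init_one : u 1 0 = c ^ (p + 1) *
    ((∏ i ∈ Finset.Ico 1 (1 + p), a i) / ∏ i ∈ Finset.Ico 1 (1 + p), b i)
  init : ∀ j : ℕ, 2 ≤ j → u j 0 = c ^ (p + 1) *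
    (((b (j - 1) - a (j - 1)) * ∏ i ∈ Finset.Ico j (j + p), a i) /
      ∏ i ∈ Finset.Ico (j - 1) (j + p), b i)

/-- The functions `f_j`, `j ≥ -p`, on the set `I`: `f_{-p} = ⋯ = f_0 = 1`; for `1 ≤ j ≤ p`,
`f_j(t) = ₚFₚ(a_j, …, a_{j+p} without a_{p+1}; b_j, …, b_{j+p-1}; c^{p+1} t)`;
for the further indices `f_{j+p}` is the analytic function given by the bilinear equation
`f_{j-1} f_j' - f_{j-1}' f_j = f_{j-p-1} f_{j+p}`, `j ≥ 1`, with `f_{j+p} = 0` in the degenerate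
case when `f_{j-p-1}` vanishes identically, so that this equation says nothing about `f_{j+p}`. -/
structure IsTauSequence (p : ℕ) (a b : ℕ → ℝ) (c : ℝ) (I : Set ℝ) (f : ℤ → ℝ → ℝ) : Prop where
  analytic : ∀ j : ℤ, -(p : ℤ) ≤ j → AnalyticOnNhd ℝ (f j) I
  eq_one : ∀ j : ℤ, -(p : ℤ) ≤ j → j ≤ 0 → ∀ t ∈ I, f j t = 1
  hypergeometric : ∀ j : ℕ, 1 ≤ j → j ≤ p → ∀ t ∈ I, f j t =
    pFq (((Finset.Icc j (j + p)).erase (p + 1)).val.map a) ((Finset.Ico j (j + p)).val.map b)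
      (c ^ (p + 1) * t)
  bilinear : ∀ j : ℤ, 1 ≤ j → ∀ t ∈ I,
    f (j - 1) t * deriv (f j) t - deriv (f (j - 1)) t * f j t = f (j - p - 1) t * f (j + p) t
  degenerate : ∀ j : ℤ, 1 ≤ j → (∀ t ∈ I, f (j - p - 1) t = 0) → ∀ t ∈ I, f (j + p) t = 0

end Bogoyavlensky

open Bogoyavlensky

namespace Bogoyavlensky

open Finset Filter Topology

/-! Put s_j = u_1 + ⋯ + u_j. The factor of u_j in the lattice telescopes to s_{j+p} - s_j - s_{j-1}
+ s_{j-p-1}. If f_j' = s_j f_j for all j, equation (1) says u_j f_{j-1} f_j = f_{j-p-1} f_{j+p}, so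
f_{j+p} can be defined from u_j and earlier functions. The lattice then makes its logarithmic
derivative s_{j+p}. By induction everything reduces to f_j' = s_j f_j for the hypergeometric
functions, 1 ≤ j ≤ p (`hasDerivAt_hypergeometricTau`).

That case rests on weighted lattice paths. For k < p the weights q_n of paths from height 0 to k
with k + (p+1)n steps satisfy q_0 = 1 and q_{n+1} = q_n' + s_{k+1} q_n (`hasDerivAt_pathWeight`), as
F^{(n)}/F does when F' = s_{k+1} F. At t = 0 the path recursion is the contiguity relation of the
hypergeometric coefficients (`hypergeometricCoeff_succ`), so q_n(0) is the n-th derivative of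
f_{k+1} at 0 (`pathWeight_zero_right`). The Leibniz recursion then gives f_{k+1}' = s_{k+1} f_{k+1}
to all orders at 0, hence on I by analyticity.

Since f_j' = s_j f_j, each f_j vanishes identically or nowhere, which settles the degenerate cases.
Local existence follows from a factorial bound on the Taylor coefficients, uniform in j because the
initial data are bounded. For the converse, nowhere vanishing f_j give the lattice by logarithmic
differentiation of (1), and the initial data by comparison with the local solution. -/

/-! ### Analytic functions and their derivatives at a point -/

/-- An analytic function on a connected set is determined by its derivatives at a point. -/
theorem eqOn_of_iteratedDeriv_eq {f g : ℝ → ℝ} {I : Set ℝ} {x : ℝ} (hI : IsPreconnected I)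
    (hx : x ∈ I) (hf : AnalyticOnNhd ℝ f I) (hg : AnalyticOnNhd ℝ g I)
    (h : ∀ n, iteratedDeriv n f x = iteratedDeriv n g x) : Set.EqOn f g I := by
  have hfg : AnalyticAt ℝ (f - g) x := (hf x hx).sub (hg x hx)
  have h0 : ∀ᶠ t in 𝓝 x, (f - g) t = 0 := by
    rw [← analyticOrderAt_eq_top]
    refine ENat.eq_top_iff_forall_ge.2 fun n => ?_
    rw [natCast_le_analyticOrderAt_iff_iteratedDeriv_eq_zero hfg]
    intro i _
    rw [iteratedDeriv_sub (hf x hx).contDiffAt (hg x hx).contDiffAt, h, sub_self]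
  refine hf.eqOn_of_preconnected_of_eventuallyEq hg hI hx ?_
  filter_upwards [h0] with t ht using sub_eq_zero.1 ht

/-- Leibniz formula for the derivatives of a solution of `f' = g h`. -/
theorem iteratedDeriv_succ_of_deriv_eq_mul {f g h : ℝ → ℝ} {x : ℝ} (hg : AnalyticAt ℝ g x)
    (hh : AnalyticAt ℝ h x) (hf : ∀ᶠ t in 𝓝 x, HasDerivAt f (g t * h t) t) (n : ℕ) :
    iteratedDeriv (n + 1) f x = ∑ i ∈ range (n + 1),
      n.choose i * iteratedDeriv i g x * iteratedDeriv (n - i) h x := by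
  rw [iteratedDeriv_succ', ← iteratedDeriv_mul hg.contDiffAt hh.contDiffAt]
  refine Filter.EventuallyEq.iteratedDeriv_eq n ?_
  filter_upwards [hf] with t ht using ht.deriv

/-- A solution of `f' = f g` vanishes identically or nowhere. -/
theorem eq_zero_or_ne_zero_of_hasDerivAt {f g : ℝ → ℝ} {I : Set ℝ} (hI : IsPreconnected I)
    (hIo : IsOpen I) (hf : AnalyticOnNhd ℝ f I) (hg : AnalyticOnNhd ℝ g I)
    (h : ∀ t ∈ I, HasDerivAt f (f t * g t) t) :
    (∀ t ∈ I, f t = 0) ∨ ∀ t ∈ I, f t ≠ 0 := by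
  by_contra! hcon
  obtain ⟨⟨s, hs, hfs⟩, x, hx, hfx⟩ := hcon
  refine hfs (eqOn_of_iteratedDeriv_eq (g := fun _ => 0) hI hx hf
    (fun _ _ => analyticAt_const) (fun n => ?_) hs)
  -- In the Leibniz formula for f' = f g every term contains a lower derivative of f at the zero x.
  have h0 : ∀ n, iteratedDeriv n f x = 0 := by
    intro n
    induction n using Nat.strong_induction_on with
    | _ n ih =>
      rcases n with _ | n
      · simpa using hfx
      · rw [iteratedDeriv_succ_of_deriv_eq_mul (hf x hx) (hg x hx)
          (eventually_of_mem (hIo.mem_nhds hx) h)]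
        refine sum_eq_zero fun i hi => ?_
        rw [ih i (by simpa using hi)]
        simp
  rw [h0]
  simp

/-- Convergent Taylor series with prescribed derivatives at the origin. -/
theorem analyticOnNhd_tsum_and_iteratedDeriv {d : ℕ → ℝ} {M K : ℝ} (hK : 0 < K)
    (hd : ∀ n, |d n| ≤ n ! * (M * K ^ n)) :
    AnalyticOnNhd ℝ (fun t => ∑' n, d n / n ! * t ^ n) (Set.Ioo (-K⁻¹) K⁻¹) ∧
      ∀ n, iteratedDeriv n (fun t => ∑' n, d n / n ! * t ^ n) 0 = d n := by
  set P := FormalMultilinearSeries.ofScalars ℝ (𝕜 := ℝ) fun n => d n / n ! with hP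
  have hrad : ENNReal.ofReal K⁻¹ ≤ P.radius := by
    refine P.le_radius_of_bound (r := K⁻¹.toNNReal) M fun n => ?_
    have h1 : |d n / n !| ≤ M * K ^ n := by
      rw [abs_div, Nat.abs_cast, div_le_iff₀ (by positivity), mul_comm]
      exact hd n
    have h2 : ‖P n‖ = |d n / n !| := by
      rw [hP, FormalMultilinearSeries.ofScalars_norm]; rfl
    rw [h2, Real.coe_toNNReal _ (by positivity)]
    calc _ ≤ M * K ^ n * K⁻¹ ^ n := by gcongr
      _ = M := by rw [mul_assoc, ← mul_pow, mul_inv_cancel₀ hK.ne', one_pow, mul_one]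
  have hpos : 0 < ENNReal.ofReal K⁻¹ := by simpa using hK
  have hsum : P.sum = fun t => ∑' n, d n / n ! * t ^ n := by
    ext t
    rw [hP]
    change FormalMultilinearSeries.ofScalarsSum (fun n => d n / n !) t = _
    rw [FormalMultilinearSeries.ofScalars_sum_eq]
    simp
  have hball := (P.hasFPowerSeriesOnBall (hpos.trans_le hrad)).mono hpos hrad
  rw [hsum] at hball
  constructor
  · have := hball.analyticOnNhd
    rwa [Metric.eball_ofReal, Real.ball_eq_Ioo, zero_sub, zero_add] at this
  · intro n
    have h := hball.factorial_smul (1 : ℝ) n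
    rw [iteratedDeriv_eq_iteratedFDeriv, ← h, hP]
    rw [FormalMultilinearSeries.ofScalars_apply_eq]
    simp
    field_simp

/-! ### The Cauchy problem: uniqueness and local existence -/

variable {p : ℕ} {a b : ℕ → ℝ} {c : ℝ} {I : Set ℝ} {u w : ℤ → ℝ → ℝ}

/-- The factor `u_{j+p} + ⋯ + u_{j+1} - u_{j-1} - ⋯ - u_{j-p}` of the lattice. -/
def latticeFactor (p : ℕ) (v : ℤ → ℝ) (j : ℤ) : ℝ :=
  ∑ i ∈ Icc 1 p, v (j + (i : ℤ)) - ∑ i ∈ Icc 1 p, v (j - (i : ℤ))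

theorem analyticAt_latticeFactor {x : ℝ} (hu : ∀ j, AnalyticAt ℝ (u j) x) (j : ℤ) :
    AnalyticAt ℝ (fun t => latticeFactor p (fun k => u k t) j) x := by
  unfold latticeFactor
  exact (Finset.analyticAt_fun_sum _ fun i _ => hu _).sub
    (Finset.analyticAt_fun_sum _ fun i _ => hu _)

theorem iteratedDeriv_latticeFactor {x : ℝ} (hu : ∀ j, AnalyticAt ℝ (u j) x) (j : ℤ) (n : ℕ) :
    iteratedDeriv n (fun t => latticeFactor p (fun k => u k t) j) x =
      latticeFactor p (fun k => iteratedDeriv n (u k) x) j := by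
  unfold latticeFactor
  rw [iteratedDeriv_fun_sub (Finset.analyticAt_fun_sum _ fun i _ => hu _).contDiffAt
    (Finset.analyticAt_fun_sum _ fun i _ => hu _).contDiffAt,
    iteratedDeriv_fun_sum fun i _ => (hu _).contDiffAt,
    iteratedDeriv_fun_sum fun i _ => (hu _).contDiffAt]

theorem IsBLSolution.iteratedDeriv_succ (hu : IsBLSolution p I u) (hIo : IsOpen I) {x : ℝ}
    (hx : x ∈ I) (n : ℕ) (j : ℤ) : iteratedDeriv (n + 1) (u j) x = ∑ i ∈ range (n + 1),
      n.choose i * iteratedDeriv i (u j) x *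
        latticeFactor p (fun k => iteratedDeriv (n - i) (u k) x) j := by
  rw [iteratedDeriv_succ_of_deriv_eq_mul (hu.analytic j x hx)
    (analyticAt_latticeFactor (p := p) (fun k => hu.analytic k x hx) j)
    (eventually_of_mem (hIo.mem_nhds hx) (hu.lattice j))]
  exact sum_congr rfl fun i _ => by
    rw [iteratedDeriv_latticeFactor fun k => hu.analytic k x hx]

/-- A solution of the lattice is determined by its values at one point. -/
theorem IsBLSolution.eqOn (hu : IsBLSolution p I u) (hw : IsBLSolution p I w) (hIo : IsOpen I)
    (hI : IsPreconnected I) {x : ℝ} (hx : x ∈ I) (h : ∀ j, u j x = w j x) (j : ℤ) :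
    Set.EqOn (u j) (w j) I := by
  refine eqOn_of_iteratedDeriv_eq hI hx (hu.analytic j) (hw.analytic j) fun n => ?_
  induction n using Nat.strong_induction_on generalizing j with
  | _ n ih =>
    rcases n with _ | n
    · simpa using h j
    · rw [hu.iteratedDeriv_succ hIo hx, hw.iteratedDeriv_succ hIo hx]
      refine sum_congr rfl fun i hi => ?_
      have hi : i ≤ n := by simpa [Nat.lt_succ_iff] using hi
      rw [ih i (by omega), funext fun k => ih (n - i) (by omega) k]

/-- The initial data of the Cauchy problem, extended by zero. -/
noncomputable def initialData (p : ℕ) (a b : ℕ → ℝ) (c : ℝ) (j : ℤ) : ℝ :=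
  if j ≤ 0 then 0 else if j = 1 then
    c ^ (p + 1) * ((∏ i ∈ Finset.Ico 1 (1 + p), a i) / ∏ i ∈ Finset.Ico 1 (1 + p), b i)
  else c ^ (p + 1) * (((b (j.toNat - 1) - a (j.toNat - 1)) *
    ∏ i ∈ Finset.Ico j.toNat (j.toNat + p), a i) /
      ∏ i ∈ Finset.Ico (j.toNat - 1) (j.toNat + p), b i)

theorem IsCauchySolution.apply_zero (hu : IsCauchySolution p a b c I u) (h0 : (0 : ℝ) ∈ I)
    (j : ℤ) : u j 0 = initialData p a b c j := by
  unfold initialData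
  split_ifs with h1 h2
  · exact hu.boundary j h1 0 h0
  · rw [h2, hu.init_one]
  · lift j to ℕ using by omega
    rw [hu.init j (by omega), Int.toNat_natCast]

theorem isCauchySolution_of_apply_zero (hu : IsBLSolution p I u) (hb : ∀ j ≤ 0, ∀ t ∈ I, u j t = 0)
    (h : ∀ j, u j 0 = initialData p a b c j) : IsCauchySolution p a b c I u where
  toIsBLSolution := hu
  boundary := hb
  init_one := by simp [h, initialData]
  init j hj := by
    rw [h, initialData, if_neg (by omega), if_neg (by omega), Int.toNat_natCast]

theorem IsCauchySolution.eqOn (hu : IsCauchySolution p a b c I u)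
    (hw : IsCauchySolution p a b c I w) (hIo : IsOpen I) (hI : IsPreconnected I)
    (h0 : (0 : ℝ) ∈ I) (j : ℤ) : Set.EqOn (u j) (w j) I :=
  hu.toIsBLSolution.eqOn hw.toIsBLSolution hIo hI h0
    (fun j => by rw [hu.apply_zero h0, hw.apply_zero h0]) j

/-- The derivatives at `0` of the solution of the lattice with the initial values `v`. -/
noncomputable def taylorCoeff (p : ℕ) (v : ℤ → ℝ) : ℕ → ℤ → ℝ
  | 0 => v
  | n + 1 => fun j => ∑ i : Fin (n + 1), n.choose i * taylorCoeff p v i j *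
      latticeFactor p (taylorCoeff p v (n - i)) j
  decreasing_by all_goals omega

theorem taylorCoeff_succ (v : ℤ → ℝ) (n : ℕ) (j : ℤ) : taylorCoeff p v (n + 1) j =
    ∑ i ∈ range (n + 1), n.choose i * taylorCoeff p v i j *
      latticeFactor p (taylorCoeff p v (n - i)) j := by
  rw [taylorCoeff, sum_range]

theorem abs_latticeFactor_le {v : ℤ → ℝ} {M : ℝ} (hv : ∀ j, |v j| ≤ M) (j : ℤ) :
    |latticeFactor p v j| ≤ 2 * p * M := by
  have h : ∀ e : ℕ → ℤ, |∑ i ∈ Icc 1 p, v (e i)| ≤ p * M := fun e =>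
    (abs_sum_le_sum_abs _ _).trans ((sum_le_sum fun i _ => hv (e i)).trans (by simp))
  calc _ ≤ _ := abs_sub _ _
    _ ≤ p * M + p * M := add_le_add (h _) (h _)
    _ = _ := by ring

/-- Each lattice factor has 2p terms, which costs 2pM per derivative. In the Leibniz sum the
binomial coefficient cancels the factorials down to n!, and the n + 1 equal bounds add up to (n +
1)!. The bound does not depend on j, so all components share a radius of convergence. -/
theorem abs_taylorCoeff_le {v : ℤ → ℝ} {M : ℝ} (hv : ∀ j, |v j| ≤ M) (n : ℕ) (j : ℤ) :
    |taylorCoeff p v n j| ≤ n ! * (M * (2 * p * M) ^ n) := by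
  have hM : 0 ≤ M := (abs_nonneg _).trans (hv 0)
  induction n using Nat.strong_induction_on generalizing j with
  | _ n ih =>
    rcases n with _ | n
    · simpa [taylorCoeff] using hv j
    · rw [taylorCoeff_succ]
      calc _ ≤ ∑ i ∈ range (n + 1), |n.choose i * taylorCoeff p v i j *
            latticeFactor p (taylorCoeff p v (n - i)) j| := abs_sum_le_sum_abs _ _
        _ ≤ ∑ i ∈ range (n + 1), n ! * (M * (2 * p * M) ^ (n + 1)) := by
          refine sum_le_sum fun i hi => ?_
          have hi : i ≤ n := by simpa [Nat.lt_succ_iff] using hi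
          rw [abs_mul, abs_mul, Nat.abs_cast]
          calc _ ≤ (n.choose i : ℝ) * (i ! * (M * (2 * p * M) ^ i)) *
                (2 * p * ((n - i)! * (M * (2 * p * M) ^ (n - i)))) := by
                gcongr
                · exact ih i (by omega) j
                · exact abs_latticeFactor_le (fun k => ih (n - i) (by omega) k) j
            _ = ((n.choose i * i ! * (n - i)! : ℕ) : ℝ) *
                (M * (2 * p * M * ((2 * p * M) ^ i * (2 * p * M) ^ (n - i)))) := by
                push_cast; ring
            _ = _ := by
                rw [Nat.choose_mul_factorial_mul_factorial hi, ← pow_add,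
                  Nat.add_sub_cancel' hi, ← pow_succ']
        _ = _ := by
          rw [sum_const, card_range, Nat.factorial_succ]
          simp
          ring

theorem taylorCoeff_eq_zero {v : ℤ → ℝ} {j : ℤ} (hv : v j = 0) (n : ℕ) :
    taylorCoeff p v n j = 0 := by
  induction n using Nat.strong_induction_on with
  | _ n ih =>
    rcases n with _ | n
    · simpa [taylorCoeff] using hv
    · rw [taylorCoeff_succ]
      exact sum_eq_zero fun i hi => by rw [ih i (by simpa using hi)]; simp

/-- Local existence for bounded initial data. -/
theorem exists_isBLSolution (hp : 1 ≤ p) {v : ℤ → ℝ} {M : ℝ} (hv : ∀ j, |v j| ≤ M) :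
    ∃ δ : ℝ, 0 < δ ∧ ∃ u : ℤ → ℝ → ℝ, IsBLSolution p (Set.Ioo (-δ) δ) u ∧
      (∀ j, u j 0 = v j) ∧ ∀ j, v j = 0 → u j = 0 := by
  -- The bound M may be 0; replacing it by max M 1 makes the growth rate 2pM positive.
  have hv' : ∀ j, |v j| ≤ max M 1 := fun j => (hv j).trans (le_max_left _ _)
  generalize max M 1 = M', le_max_right M 1 = hM at hv'
  have hp' : (1 : ℝ) ≤ p := by exact_mod_cast hp
  have hK : 0 < 2 * p * M' := by positivity
  have key := fun j => analyticOnNhd_tsum_and_iteratedDeriv hK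
    fun n => abs_taylorCoeff_le (p := p) hv' n j
  set u : ℤ → ℝ → ℝ := fun j t => ∑' n, taylorCoeff p v n j / n ! * t ^ n with hu
  have hδ : 0 < (2 * p * M')⁻¹ := by positivity
  have h0 : (0 : ℝ) ∈ Set.Ioo (-(2 * p * M')⁻¹) (2 * p * M')⁻¹ := by simpa using hδ
  refine ⟨_, hδ, u, ⟨fun j => (key j).1, fun j t ht => ?_⟩, fun j => ?_, fun j hj => ?_⟩
  · have hd : deriv (u j) t = u j t * latticeFactor p (fun k => u k t) j := by
      refine eqOn_of_iteratedDeriv_eq (g := fun t => u j t * latticeFactor p (fun k => u k t) j)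
        isPreconnected_Ioo h0 (key j).1.deriv
        (fun x hx => ((key j).1 x hx).mul (analyticAt_latticeFactor (fun k => (key k).1 x hx) j))
        (fun n => ?_) ht
      rw [← iteratedDeriv_succ', iteratedDeriv_fun_mul ((key j).1 0 h0).contDiffAt
        (analyticAt_latticeFactor (fun k => (key k).1 0 h0) j).contDiffAt, (key j).2,
        taylorCoeff_succ]
      refine sum_congr rfl fun i _ => ?_
      rw [iteratedDeriv_latticeFactor (fun k => (key k).1 0 h0), (key j).2,
        funext fun k => (key k).2 (n - i)]
    have := ((key j).1 t ht).differentiableAt.hasDerivAt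
    rw [hd] at this
    exact this
  · have := (key j).2 0
    simpa [taylorCoeff] using this
  · ext t
    simp [hu, taylorCoeff_eq_zero hj]

/-! ### Boundedness of the initial data -/

/-- The quotients of two shifted linear sequences are bounded. -/
theorem exists_abs_div_le (x y α β : ℝ) (hβ : β ≠ 0) :
    ∃ D : ℝ, ∀ n : ℕ, |(x + n * α) / (y + n * β)| ≤ D := by
  have h1 : Tendsto (fun n : ℕ => (x + n * α) / (y + n * β)) atTop (𝓝 (α / β)) := by
    have hx : ∀ z γ : ℝ, Tendsto (fun n : ℕ => z / n + γ) atTop (𝓝 γ) := fun z γ => by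
      simpa using (tendsto_const_div_atTop_nhds_zero_nat z).add_const γ
    refine ((hx x α).div (hx y β) hβ).congr' ?_
    filter_upwards [eventually_gt_atTop 0] with n hn
    have hn : (n : ℝ) ≠ 0 := by positivity
    rw [Pi.div_apply, div_add' _ _ _ hn, div_add' _ _ _ hn, div_div_div_cancel_right₀ hn,
      mul_comm α, mul_comm β]
  obtain ⟨D, hD⟩ := h1.abs.bddAbove_range
  exact ⟨D, fun n => hD ⟨n, rfl⟩⟩

theorem shift_mul {x : ℕ → ℝ} {q : ℕ} (h : ∀ j, x (j + q) = x j + 1) (j n : ℕ) :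
    x (j + q * n) = x j + n := by
  induction n with
  | zero => simp
  | succ n ih => rw [mul_add, mul_one, ← add_assoc, h, ih]; push_cast; ring

/-- Write i = r + p(p+1)m. Then a_i = a_r + pm and b_i = b_r + (p+1)m, so the ratio is bounded for
each of the finitely many residues r. -/
theorem exists_abs_parameter_ratio_le (hp : 1 ≤ p) (ha : ∀ j : ℕ, a (j + p + 1) = a j + 1)
    (hb : ∀ j : ℕ, b (j + p) = b j + 1) : ∃ D : ℝ, 1 ≤ D ∧ ∀ i, |a i / b i| ≤ D := by
  choose D hD using fun r => exists_abs_div_le (a r) (b r) p (p + 1) (by positivity)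
  refine ⟨1 + ∑ r ∈ range (p * (p + 1)), |D r|,
    le_add_of_nonneg_right (sum_nonneg fun _ _ => abs_nonneg _), fun i => ?_⟩
  have hq : 0 < p * (p + 1) := by positivity
  have hi := Nat.mod_add_div i (p * (p + 1))
  have ea : a i = a (i % (p * (p + 1))) + (i / (p * (p + 1)) : ℕ) * p := by
    have := shift_mul (q := p + 1) ha (i % (p * (p + 1))) (p * (i / (p * (p + 1))))
    rw [show i % (p * (p + 1)) + (p + 1) * (p * (i / (p * (p + 1)))) = i by
      rw [← mul_assoc, mul_comm (p + 1) p, hi]] at this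
    rw [this]; push_cast; ring
  have eb : b i = b (i % (p * (p + 1))) + (i / (p * (p + 1)) : ℕ) * (p + 1) := by
    have := shift_mul hb (i % (p * (p + 1))) ((p + 1) * (i / (p * (p + 1))))
    rw [← mul_assoc, hi] at this
    rw [this]; push_cast; ring
  rw [ea, eb]
  calc _ ≤ D (i % (p * (p + 1))) := hD _ _
    _ ≤ |D (i % (p * (p + 1)))| := le_abs_self _
    _ ≤ ∑ r ∈ range (p * (p + 1)), |D r| :=
      single_le_sum (f := fun r => |D r|) (fun _ _ => abs_nonneg _)
        (mem_range.2 (Nat.mod_lt _ hq))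
    _ ≤ _ := by linarith

theorem exists_abs_initialData_le (hp : 1 ≤ p) (ha : ∀ j : ℕ, a (j + p + 1) = a j + 1)
    (hb : ∀ j : ℕ, b (j + p) = b j + 1) (hb' : ∀ j : ℕ, 0 < j → b j ≠ 0) :
    ∃ M : ℝ, ∀ j, |initialData p a b c j| ≤ M := by
  obtain ⟨D, hD1, hD⟩ := exists_abs_parameter_ratio_le hp ha hb
  have hprod : ∀ m, |(∏ i ∈ Ico m (m + p), a i) / ∏ i ∈ Ico m (m + p), b i| ≤ D ^ p := by
    intro m
    rw [← prod_div_distrib, abs_prod]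
    exact (prod_le_prod (fun _ _ => abs_nonneg _) fun i _ => hD i).trans (by simp)
  refine ⟨|c ^ (p + 1)| * ((1 + D) * D ^ p), fun j => ?_⟩
  have hD0 : 0 ≤ D ^ p := by positivity
  unfold initialData
  split_ifs with h1 h2
  · rw [abs_zero]; positivity
  · rw [abs_mul]
    gcongr
    exact (hprod 1).trans (by nlinarith)
  · obtain ⟨k, hk, rfl⟩ : ∃ k : ℕ, 0 < k ∧ j = (k + 1 : ℕ) := ⟨j.toNat - 1, by omega, by omega⟩
    rw [Int.toNat_natCast, Nat.add_sub_cancel, abs_mul]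
    gcongr
    -- The first factor of the denominator is split off: (b_k - a_k)/b_k = 1 - a_k/b_k has absolute
    -- value at most 1 + D.
    rw [prod_eq_prod_Ico_succ_bot (by omega : k < k + 1 + p), mul_div_mul_comm, abs_mul, sub_div,
      div_self (hb' k hk)]
    gcongr
    · exact (abs_sub _ _).trans (by simpa using hD k)
    · exact hprod _

theorem exists_isCauchySolution (hp : 1 ≤ p) (ha : ∀ j : ℕ, a (j + p + 1) = a j + 1)
    (hb : ∀ j : ℕ, b (j + p) = b j + 1) (hb' : ∀ j : ℕ, 0 < j → b j ≠ 0) :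
    ∃ δ : ℝ, 0 < δ ∧ ∃ u : ℤ → ℝ → ℝ, IsCauchySolution p a b c (Set.Ioo (-δ) δ) u := by
  obtain ⟨M, hM⟩ := exists_abs_initialData_le (c := c) hp ha hb hb'
  obtain ⟨δ, hδ, u, hu, hu0, hz⟩ := exists_isBLSolution hp hM
  refine ⟨δ, hδ, u, isCauchySolution_of_apply_zero hu (fun j hj t _ => ?_) hu0⟩
  rw [hz j (by simp [initialData, hj])]
  rfl

/-! ### Hypergeometric coefficients and contiguity -/

theorem ascPochhammer_eval_succ_left (n : ℕ) (x : ℝ) :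
    (ascPochhammer ℝ (n + 1)).eval x = x * (ascPochhammer ℝ n).eval (x + 1) := by
  rw [ascPochhammer_succ_left, Polynomial.eval_mul, Polynomial.eval_comp]
  simp

theorem ascPochhammer_eval_ne_zero {x : ℝ} (hx : ∀ n : ℕ, x + n ≠ 0) (n : ℕ) :
    (ascPochhammer ℝ n).eval x ≠ 0 := by
  induction n with
  | zero => simp
  | succ n ih => rw [ascPochhammer_succ_eval]; exact mul_ne_zero ih (hx n)

theorem exists_abs_ascPochhammer_div_le (x y : ℝ) :
    ∃ D : ℝ, ∀ n, |(ascPochhammer ℝ n).eval x / (ascPochhammer ℝ n).eval y| ≤ D ^ n := by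
  obtain ⟨D, hD⟩ := exists_abs_div_le x y 1 1 one_ne_zero
  refine ⟨D, fun n => ?_⟩
  induction n with
  | zero => simp
  | succ n ih =>
    rw [ascPochhammer_succ_eval, ascPochhammer_succ_eval, mul_div_mul_comm, abs_mul, pow_succ]
    have := hD n
    rw [mul_one] at this
    exact mul_le_mul ih this (abs_nonneg _) ((abs_nonneg _).trans ih)

/-- The coefficients of the series `ₚ₊₁Fₚ(a_{k+1}, …, a_{k+p+1}; b_{k+1}, …, b_{k+p}; z)`. -/
noncomputable def hypergeometricCoeff (p : ℕ) (a b : ℕ → ℝ) (k n : ℕ) : ℝ :=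
  (∏ i ∈ range (p + 1), (ascPochhammer ℝ n).eval (a (k + 1 + i))) /
    ((∏ i ∈ range p, (ascPochhammer ℝ n).eval (b (k + 1 + i))) * n !)

theorem hypergeometricCoeff_zero_right (k : ℕ) : hypergeometricCoeff p a b k 0 = 1 := by
  simp [hypergeometricCoeff]

theorem prod_ascPochhammer_succ_eval (x : ℕ → ℝ) (q m n : ℕ) :
    ∏ i ∈ range q, (ascPochhammer ℝ (n + 1)).eval (x (m + i)) =
      (∏ i ∈ range q, x (m + i)) * ∏ i ∈ range q, (ascPochhammer ℝ n).eval (x (m + i) + 1) := by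
  rw [← prod_mul_distrib]
  exact prod_congr rfl fun i _ => ascPochhammer_eval_succ_left _ _

theorem add_natCast_ne_zero {x : ℕ → ℝ} {q : ℕ} (h : ∀ j, x (j + q) = x j + 1)
    (h0 : ∀ j, 0 < j → x j ≠ 0) {j : ℕ} (hj : 0 < j) (n : ℕ) : x j + n ≠ 0 := by
  rw [← shift_mul h]
  exact h0 _ (by omega)

/-- As b_{k+1+p} = b_{k+1} + 1, moving the window by one replaces (b_{k+1})_n by (b_{k+1} + 1)_n,
and these differ by the factor (b_{k+1} + n)/b_{k+1}. -/
theorem prod_ascPochhammer_shift (hb : ∀ j : ℕ, b (j + p) = b j + 1)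
    (hb' : ∀ j : ℕ, 0 < j → b j ≠ 0) (k n : ℕ) :
    (∏ i ∈ range p, (ascPochhammer ℝ n).eval (b (k + 1 + i))) * (b (k + 1) + n) =
      b (k + 1) * ∏ i ∈ range p, (ascPochhammer ℝ n).eval (b (k + 1 + 1 + i)) := by
  have hne : (ascPochhammer ℝ n).eval (b (k + 1)) ≠ 0 :=
    ascPochhammer_eval_ne_zero (add_natCast_ne_zero hb hb' (Nat.succ_pos k)) n
  have h1 : (ascPochhammer ℝ n).eval (b (k + 1)) * (b (k + 1) + n) =
      b (k + 1) * (ascPochhammer ℝ n).eval (b (k + 1) + 1) := by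
    rw [← ascPochhammer_succ_eval, ascPochhammer_eval_succ_left]
  have h2 : (∏ i ∈ range p, (ascPochhammer ℝ n).eval (b (k + 1 + i))) *
      (ascPochhammer ℝ n).eval (b (k + 1) + 1) = (ascPochhammer ℝ n).eval (b (k + 1)) *
      ∏ i ∈ range p, (ascPochhammer ℝ n).eval (b (k + 1 + 1 + i)) := by
    rw [← hb, ← prod_range_succ (fun i => (ascPochhammer ℝ n).eval (b (k + 1 + i))),
      prod_range_succ', mul_comm]
    simp only [add_zero]
    congr 1
    exact prod_congr rfl fun i _ => by rw [show k + 1 + (i + 1) = k + 1 + 1 + i by omega]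
  refine mul_left_cancel₀ hne ?_
  linear_combination (∏ i ∈ range p, (ascPochhammer ℝ n).eval (b (k + 1 + i))) * h1 +
    b (k + 1) * h2

/-- The contiguity relation of Euler and Gauss. -/
theorem hypergeometricCoeff_succ (ha : ∀ j : ℕ, a (j + p + 1) = a j + 1)
    (hb : ∀ j : ℕ, b (j + p) = b j + 1) (hb' : ∀ j : ℕ, 0 < j → b j ≠ 0) (k n : ℕ) :
    hypergeometricCoeff p a b (k + 1) (n + 1) = hypergeometricCoeff p a b k (n + 1) +
      ((b (k + 1) - a (k + 1)) * ∏ i ∈ Ico (k + 2) (k + 2 + p), a i) /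
        (∏ i ∈ Ico (k + 1) (k + 2 + p), b i) * hypergeometricCoeff p a b (k + 1 + p) n := by
  -- All products are reduced to common factors. With α = a_{k+1}, β = b_{k+1}, N = n + 1, what
  -- remains is β(α + N) = α(β + N) + (β - α)N.
  have hA1 : ∏ i ∈ range (p + 1), (ascPochhammer ℝ (n + 1)).eval (a (k + 1 + 1 + i)) =
      ((∏ i ∈ range p, a (k + 2 + i)) *
        ∏ i ∈ range p, (ascPochhammer ℝ n).eval (a (k + 2 + i) + 1)) *
        ((ascPochhammer ℝ n).eval (a (k + 1) + 1) * (a (k + 1) + 1 + n)) := by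
    rw [prod_range_succ, prod_ascPochhammer_succ_eval, ← ascPochhammer_succ_eval, ← ha,
      show k + 1 + p + 1 = k + 1 + 1 + p by omega]
  have hA2 : ∏ i ∈ range (p + 1), (ascPochhammer ℝ (n + 1)).eval (a (k + 1 + i)) =
      ((∏ i ∈ range p, a (k + 2 + i)) *
        ∏ i ∈ range p, (ascPochhammer ℝ n).eval (a (k + 2 + i) + 1)) *
        (a (k + 1) * (ascPochhammer ℝ n).eval (a (k + 1) + 1)) := by
    rw [prod_range_succ', add_zero, ← ascPochhammer_eval_succ_left,
      ← prod_ascPochhammer_succ_eval]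
    congr 1
    exact prod_congr rfl fun i _ => by rw [show k + 1 + (i + 1) = k + 2 + i by omega]
  have hA3 : ∏ i ∈ range (p + 1), (ascPochhammer ℝ n).eval (a (k + 1 + p + 1 + i)) =
      (∏ i ∈ range p, (ascPochhammer ℝ n).eval (a (k + 2 + i) + 1)) *
        (ascPochhammer ℝ n).eval (a (k + 1) + 1) := by
    rw [prod_range_succ', add_zero, ha]
    congr 1
    exact prod_congr rfl fun i _ => by
      rw [← ha, show k + 1 + p + 1 + (i + 1) = k + 2 + i + p + 1 by omega]
  have hB1 : ∏ i ∈ range p, (ascPochhammer ℝ (n + 1)).eval (b (k + 1 + 1 + i)) =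
      (∏ i ∈ range p, b (k + 2 + i)) *
        ∏ i ∈ range p, (ascPochhammer ℝ n).eval (b (k + 2 + i) + 1) :=
    prod_ascPochhammer_succ_eval _ _ _ _
  have hB2 := prod_ascPochhammer_shift hb hb' k (n + 1)
  have hB3 : ∏ i ∈ range p, (ascPochhammer ℝ n).eval (b (k + 1 + p + 1 + i)) =
      ∏ i ∈ range p, (ascPochhammer ℝ n).eval (b (k + 2 + i) + 1) :=
    prod_congr rfl fun i _ => by rw [← hb, show k + 1 + p + 1 + i = k + 2 + i + p by omega]
  have hpos : ∀ i, 0 < k + 2 + i := fun i => by omega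
  have hβ : ∏ i ∈ range p, b (k + 2 + i) ≠ 0 := prod_ne_zero_iff.2 fun i _ => hb' _ (hpos i)
  have hR : ∏ i ∈ range p, (ascPochhammer ℝ n).eval (b (k + 2 + i) + 1) ≠ 0 :=
    prod_ne_zero_iff.2 fun i _ => by
      rw [← hb]
      exact ascPochhammer_eval_ne_zero (add_natCast_ne_zero hb hb' (by omega)) n
  have hbk : b (k + 1) ≠ 0 := hb' _ (Nat.succ_pos k)
  have hbn : b (k + 1) + ((n + 1 : ℕ) : ℝ) ≠ 0 := add_natCast_ne_zero hb hb' (Nat.succ_pos k) _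
  have hf : (n ! : ℝ) ≠ 0 := by positivity
  rw [hB1] at hB2
  unfold hypergeometricCoeff
  rw [hA1, hA2, hA3, hB1, hB3, eq_div_of_mul_eq hbn hB2, prod_eq_prod_Ico_succ_bot (by omega : k + 1 < k + 2 + p) b,
    prod_Ico_eq_prod_range, prod_Ico_eq_prod_range, Nat.factorial_succ,
    show k + 2 + p - (k + 2) = p by omega]
  simp only [show k + 1 + 1 = k + 2 from rfl]
  push_cast at hbn ⊢
  field_simp
  ring

/-- This is the boundary form of the contiguity relation, matching paths that end at height 0, where
no step arrives from below. Because a_{p+1} = 1, its Pochhammer symbol cancels the factorial on both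
sides. -/
theorem hypergeometricCoeff_zero_succ (ha : ∀ j : ℕ, a (j + p + 1) = a j + 1)
    (hb : ∀ j : ℕ, b (j + p) = b j + 1) (ha0 : a 0 = 0) (n : ℕ) :
    hypergeometricCoeff p a b 0 (n + 1) =
      (∏ i ∈ Ico 1 (1 + p), a i) / (∏ i ∈ Ico 1 (1 + p), b i) *
        hypergeometricCoeff p a b p n := by
  have h1 : a (p + 1) = 1 := by simpa [ha0] using ha 0
  have hA3 : ∏ i ∈ range (p + 1), (ascPochhammer ℝ n).eval (a (p + 1 + i)) =
      (∏ i ∈ range p, (ascPochhammer ℝ n).eval (a (1 + i) + 1)) * n ! := by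
    rw [prod_range_succ', add_zero, h1, ascPochhammer_eval_one]
    congr 1
    exact prod_congr rfl fun i _ => by
      rw [← ha, show p + 1 + (i + 1) = 1 + i + p + 1 by omega]
  have hB3 : ∏ i ∈ range p, (ascPochhammer ℝ n).eval (b (p + 1 + i)) =
      ∏ i ∈ range p, (ascPochhammer ℝ n).eval (b (1 + i) + 1) :=
    prod_congr rfl fun i _ => by rw [← hb, show p + 1 + i = 1 + i + p by omega]
  have hf : (n ! : ℝ) ≠ 0 := by positivity
  have hf' : ((n + 1)! : ℝ) ≠ 0 := by positivity
  unfold hypergeometricCoeff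
  simp only [zero_add]
  rw [prod_range_succ, add_comm 1 p, h1, ascPochhammer_eval_one, prod_ascPochhammer_succ_eval,
    prod_ascPochhammer_succ_eval, hA3, hB3, prod_Ico_eq_prod_range, prod_Ico_eq_prod_range,
    Nat.add_sub_cancel, mul_div_mul_right _ _ hf', mul_div_mul_right _ _ hf, mul_div_mul_comm]

/-- With n! = (1)_n there are as many Pochhammer symbols below as above, and each quotient grows at
most geometrically. -/
theorem exists_abs_hypergeometricCoeff_le (k : ℕ) :
    ∃ D : ℝ, ∀ n, |hypergeometricCoeff p a b k n| ≤ D ^ n := by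
  choose D hD using exists_abs_ascPochhammer_div_le
  refine ⟨(∏ i ∈ range p, D (a (k + 1 + i)) (b (k + 1 + i))) * D (a (k + 1 + p)) 1, fun n => ?_⟩
  rw [hypergeometricCoeff, prod_range_succ, mul_div_mul_comm, ← prod_div_distrib, abs_mul,
    abs_prod, mul_pow, ← prod_pow, ← ascPochhammer_eval_one]
  exact mul_le_mul (prod_le_prod (fun _ _ => abs_nonneg _) fun i _ => hD _ _ _) (hD _ _ _)
    (abs_nonneg _) (prod_nonneg fun i _ => (abs_nonneg _).trans (hD _ _ n))

/-! ### The hypergeometric functions as entire series -/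

/-- The hypergeometric function `f_j`, `1 ≤ j ≤ p`. -/
noncomputable def hypergeometricTau (p : ℕ) (a b : ℕ → ℝ) (c : ℝ) (j : ℕ) (t : ℝ) : ℝ :=
  pFq (((Icc j (j + p)).erase (p + 1)).val.map a) ((Ico j (j + p)).val.map b) (c ^ (p + 1) * t)

/-- The omitted upper parameter a_{p+1} = 1 would contribute (1)_n = n!. Restoring it gives the
coefficients of ₚ₊₁Fₚ divided by n!, so those coefficients, up to powers of c^{p+1}, are the
derivatives at 0. -/
theorem hypergeometricTau_eq (h1 : a (p + 1) = 1) {k : ℕ} (hk : k < p) :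
    hypergeometricTau p a b c (k + 1) = fun t =>
      ∑' n, hypergeometricCoeff p a b k n * (c ^ (p + 1)) ^ n / n ! * t ^ n := by
  ext t
  refine tsum_congr fun n => ?_
  have hA : (∏ i ∈ (Icc (k + 1) (k + 1 + p)).erase (p + 1), (ascPochhammer ℝ n).eval (a i)) * n ! =
      ∏ i ∈ range (p + 1), (ascPochhammer ℝ n).eval (a (k + 1 + i)) := by
    rw [← ascPochhammer_eval_one, ← h1, prod_erase_mul _ (fun i => (ascPochhammer ℝ n).eval (a i))
      (by simp; omega), ← Finset.Ico_add_one_right_eq_Icc, prod_Ico_eq_prod_range,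
      show k + 1 + p + 1 - (k + 1) = p + 1 by omega]
  have hf : (n ! : ℝ) ≠ 0 := by positivity
  simp only [Multiset.map_map, Function.comp_def]
  change (∏ i ∈ (Icc (k + 1) (k + 1 + p)).erase (p + 1), (ascPochhammer ℝ n).eval (a i)) /
    (∏ i ∈ Ico (k + 1) (k + 1 + p), (ascPochhammer ℝ n).eval (b i)) * _ = _
  rw [hypergeometricCoeff, ← hA, mul_div_mul_right _ _ hf, prod_Ico_eq_prod_range,
    Nat.add_sub_cancel_left, mul_pow]
  ring

theorem hypergeometricTau_analytic_and_iteratedDeriv (h1 : a (p + 1) = 1) {k : ℕ} (hk : k < p) :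
    (∀ t, AnalyticAt ℝ (hypergeometricTau p a b c (k + 1)) t) ∧
      ∀ n, iteratedDeriv n (hypergeometricTau p a b c (k + 1)) 0 =
        hypergeometricCoeff p a b k n * (c ^ (p + 1)) ^ n := by
  obtain ⟨D, hD⟩ := exists_abs_hypergeometricCoeff_le (p := p) (a := a) (b := b) k
  have hD0 : 0 ≤ D := by simpa using (abs_nonneg _).trans (hD 1)
  -- Geometric growth of the derivatives is within n! K^n for every K > 0, up to a constant, because
  -- x^n/n! ≤ e^x. So the radius of convergence is infinite.
  have key : ∀ K : ℝ, 0 < K → ∀ n, |hypergeometricCoeff p a b k n * (c ^ (p + 1)) ^ n| ≤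
      n ! * (Real.exp (D * |c ^ (p + 1)| / K) * K ^ n) := by
    intro K hK n
    calc _ ≤ D ^ n * |c ^ (p + 1)| ^ n := by
          rw [abs_mul, abs_pow _ n]
          gcongr
          exact hD n
      _ = n ! * ((D * |c ^ (p + 1)| / K) ^ n / n ! * K ^ n) := by
          rw [div_pow, mul_pow]
          field_simp
      _ ≤ _ := by
          gcongr
          exact Real.pow_div_factorial_le_exp _ (by positivity) n
  rw [hypergeometricTau_eq h1 hk]
  refine ⟨fun t => ?_, (analyticOnNhd_tsum_and_iteratedDeriv one_pos (key 1 one_pos)).2⟩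
  have hK : 0 < (|t| + 1)⁻¹ := by positivity
  refine (analyticOnNhd_tsum_and_iteratedDeriv hK (key _ hK)).1 t ?_
  rw [inv_inv, Set.mem_Ioo, ← abs_lt]
  linarith

theorem hypergeometricTau_zero (h1 : a (p + 1) = 1) {k : ℕ} (hk : k < p) :
    hypergeometricTau p a b c (k + 1) 0 = 1 := by
  simpa [hypergeometricCoeff_zero_right] using
    (hypergeometricTau_analytic_and_iteratedDeriv (b := b) (c := c) h1 hk).2 0

/-! ### Partial sums and the telescoped lattice -/

theorem latticeFactor_eq_of_telescope {v s : ℤ → ℝ} (h : ∀ k, s k = s (k - 1) + v k) (j : ℤ) :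
    latticeFactor p v j = s (j + p) - s j - s (j - 1) + s (j - p - 1) := by
  have h1 : ∀ q : ℕ, ∑ i ∈ Icc 1 q, v (j + (i : ℤ)) = s (j + q) - s j := fun q => by
    induction q with
    | zero => simp
    | succ q ih =>
      rw [sum_Icc_succ_top (by omega), ih, h (j + (q + 1 : ℕ)),
        show j + ((q + 1 : ℕ) : ℤ) - 1 = j + q by push_cast; ring]
      ring
  have h2 : ∀ q : ℕ, ∑ i ∈ Icc 1 q, v (j - (i : ℤ)) = s (j - 1) - s (j - q - 1) := fun q => by
    induction q with
    | zero => simp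
    | succ q ih =>
      rw [sum_Icc_succ_top (by omega), ih, show j - (q : ℤ) - 1 = j - (q + 1 : ℕ) by push_cast; ring,
        h (j - (q + 1 : ℕ))]
      ring
  rw [latticeFactor, h1, h2]
  ring

/-- The sums `u_1 + ⋯ + u_j`. -/
def partialSum (u : ℤ → ℝ → ℝ) (j : ℤ) (t : ℝ) : ℝ :=
  ∑ i ∈ range j.toNat, u (i + 1) t

theorem partialSum_of_nonpos {j : ℤ} (hj : j ≤ 0) (t : ℝ) : partialSum u j t = 0 := by
  simp [partialSum, Int.toNat_of_nonpos hj]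

theorem partialSum_eq_add {t : ℝ} (hb : ∀ j ≤ 0, u j t = 0) (j : ℤ) :
    partialSum u j t = partialSum u (j - 1) t + u j t := by
  rcases le_or_gt j 0 with hj | hj
  · rw [partialSum_of_nonpos hj, partialSum_of_nonpos (by omega), hb j hj, zero_add]
  · obtain ⟨k, rfl⟩ : ∃ k : ℕ, j = (k + 1 : ℕ) := ⟨j.toNat - 1, by omega⟩
    simp [partialSum, sum_range_succ]

theorem analyticOnNhd_partialSum (hu : IsBLSolution p I u) (j : ℤ) :
    AnalyticOnNhd ℝ (partialSum u j) I :=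
  fun x hx => Finset.analyticAt_fun_sum _ fun _ _ => hu.analytic _ x hx

theorem IsCauchySolution.hasDerivAt (hu : IsCauchySolution p a b c I u) (j : ℤ) {t : ℝ}
    (ht : t ∈ I) : HasDerivAt (u j) (u j t * (partialSum u (j + p) t - partialSum u j t -
      partialSum u (j - 1) t + partialSum u (j - p - 1) t)) t := by
  have : HasDerivAt (u j) (u j t * latticeFactor p (fun k => u k t) j) t := hu.lattice j t ht
  rwa [latticeFactor_eq_of_telescope (v := fun k => u k t)
    (s := fun k => partialSum u k t) (partialSum_eq_add fun k hk => hu.boundary k hk t ht)] at this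

/-! ### Lattice paths and the Lax equation -/

/-- Total weights of the lattice paths from height `0` to height `k` with `m` steps, where the
steps go up by `1`, or down by `p` from height `l + p` with the weight `u_{l+1}`. -/
def pathWeight (p : ℕ) (u : ℤ → ℝ → ℝ) : ℕ → ℤ → ℝ → ℝ
  | 0, k, _ => if k = 0 then 1 else 0
  | m + 1, k, t => pathWeight p u m (k - 1) t + pathWeight p u m (k + p) t * u (k + 1) t

theorem pathWeight_succ (m : ℕ) (k : ℤ) (t : ℝ) : pathWeight p u (m + 1) k t =
    pathWeight p u m (k - 1) t + pathWeight p u m (k + p) t * u (k + 1) t := rfl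

theorem pathWeight_of_lt {m : ℕ} {k : ℤ} (h : (m : ℤ) < k) (t : ℝ) :
    pathWeight p u m k t = 0 := by
  induction m generalizing k with
  | zero => simp [pathWeight]; omega
  | succ m ih => rw [pathWeight, ih (by omega), ih (by omega)]; simp

theorem pathWeight_of_neg {t : ℝ} (hb : ∀ j ≤ 0, u j t = 0) (m : ℕ) {k : ℤ} (h : k < 0) :
    pathWeight p u m k t = 0 := by
  induction m generalizing k with
  | zero => simp [pathWeight]; omega
  | succ m ih => rw [pathWeight, ih (by omega), hb (k + 1) (by omega)]; simp

/-- A descent by p that ends at a nonnegative height needs p ascents before it, and lower descents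
have weight 0. So only the purely ascending path counts. -/
theorem pathWeight_of_le {t : ℝ} (hb : ∀ j ≤ 0, u j t = 0) {m : ℕ} (hm : m ≤ p) (k : ℤ) :
    pathWeight p u m k t = if k = m then 1 else 0 := by
  induction m generalizing k with
  | zero => simp [pathWeight]
  | succ m ih =>
    rw [pathWeight, ih (by omega), ih (by omega)]
    rcases le_or_gt (k + 1) 0 with hk | hk
    · rw [hb _ hk, mul_zero, add_zero, if_neg (by omega), if_neg (by push_cast; omega)]
    · rw [if_neg (by omega : ¬k + p = m), zero_mul, add_zero]
      exact if_congr (by omega) rfl rfl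

/-- This is a Lax equation. If L is the one-step operator, the weights form the vector L^m e_0, and
its derivative is the strictly descending part of L^{p+1} applied to it. The two subtracted terms
are the other parts of L^{p+1}: one descent among p + 1 steps returns to height k with total weight
u_{k-p+1} + ⋯ + u_{k+1}, and p + 1 ascents start from k - p - 1. -/
theorem hasDerivAt_pathWeight (hu : IsCauchySolution p a b c I u) {t : ℝ} (ht : t ∈ I)
    (m : ℕ) (k : ℤ) : HasDerivAt (pathWeight p u m k) (pathWeight p u (m + p + 1) k t -
      pathWeight p u m k t * (partialSum u (k + 1) t - partialSum u (k - p) t) -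
      pathWeight p u m (k - p - 1) t) t := by
  have hb : ∀ j ≤ 0, u j t = 0 := fun j hj => hu.boundary j hj t ht
  induction m generalizing k with
  | zero =>
    convert! hasDerivAt_const t (if k = 0 then (1 : ℝ) else 0) using 1
    rw [zero_add, pathWeight_succ, pathWeight_of_le hb le_rfl, pathWeight_of_le hb le_rfl]
    simp only [pathWeight]
    rcases eq_or_ne k 0 with rfl | hk
    · have h1 := partialSum_eq_add hb 1
      rw [sub_self, partialSum_of_nonpos le_rfl, zero_add] at h1
      rw [partialSum_of_nonpos (by omega : (0 : ℤ) - p ≤ 0), zero_add, zero_add, h1,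
        if_neg (by omega : ¬(0 : ℤ) - 1 = p), if_neg (by omega : ¬(0 : ℤ) - p - 1 = 0)]
      simp
    · rw [if_neg hk, if_neg (by omega : ¬k + p = p)]
      rcases eq_or_ne k (p + 1) with rfl | hk'
      · simp
      · rw [if_neg (by omega), if_neg (by omega)]; simp
  | succ m ih =>
    convert! (ih (k - 1)).add ((ih (k + p)).mul (hu.hasDerivAt (k + 1) ht)) using 1
    have e1 := partialSum_eq_add hb (k + 1)
    have e2 := partialSum_eq_add hb (k - p)
    rw [show m + 1 + p + 1 = m + p + 1 + 1 by omega]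
    simp only [pathWeight_succ]
    rw [show k - p - 1 + p = k - 1 by ring, show k - p - 1 + 1 = k - p by ring,
      show k - 1 + 1 = k by ring, show k - 1 - p = k - p - 1 by ring,
      show k + p - p = k by ring, show k + 1 + p = k + p + 1 by ring,
      show k + 1 - 1 = k by ring, show k + 1 - p - 1 = k - p by ring] at *
    linear_combination (-pathWeight p u m (k - 1) t) * e1 + pathWeight p u m (k - 1) t * e2

/-- Induction on the number of steps. The last step comes from height k - 1 with the same n, or from
k + p with n lowered by one. With u_{k+1}(0) as the weight of the descent, this is the contiguity
relation. -/
theorem pathWeight_zero_right (hu : IsCauchySolution p a b c I u) (h0 : (0 : ℝ) ∈ I)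
    (ha : ∀ j : ℕ, a (j + p + 1) = a j + 1) (hb : ∀ j : ℕ, b (j + p) = b j + 1) (ha0 : a 0 = 0)
    (hb' : ∀ j : ℕ, 0 < j → b j ≠ 0) (k n : ℕ) :
    pathWeight p u (k + (p + 1) * n) k 0 =
      hypergeometricCoeff p a b k n * (c ^ (p + 1)) ^ n := by
  have hz : ∀ j ≤ 0, u j 0 = 0 := fun j hj => hu.boundary j hj 0 h0
  obtain ⟨m, hm⟩ : ∃ m, m = k + (p + 1) * n := ⟨_, rfl⟩
  rw [← hm]
  induction m generalizing k n with
  | zero =>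
    obtain ⟨rfl, rfl⟩ : k = 0 ∧ n = 0 := by
      rcases n with _ | n
      · omega
      · rw [mul_add] at hm; omega
    simp [pathWeight, hypergeometricCoeff_zero_right]
  | succ m ih =>
    rw [pathWeight]
    rcases n with _ | n
    · obtain ⟨k, rfl⟩ : ∃ l, k = l + 1 := ⟨k - 1, by omega⟩
      rw [pathWeight_of_lt (k := ((k + 1 : ℕ) : ℤ) + p) (by omega),
        show ((k + 1 : ℕ) : ℤ) - 1 = k by omega, ih k 0 (by omega)]
      simp [hypergeometricCoeff_zero_right]
    · have hm' : m = k + p + (p + 1) * n := by rw [mul_add] at hm; omega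
      have e : (k : ℤ) + p = (k + p : ℕ) := by omega
      rw [e, ih (k + p) n hm']
      rcases k with _ | k
      · rw [pathWeight_of_neg hz _ (by omega), hypergeometricCoeff_zero_succ ha hb ha0]
        simp only [Nat.cast_zero, zero_add]
        rw [hu.init_one]
        ring
      · rw [show ((k + 1 : ℕ) : ℤ) - 1 = k by omega, ih k (n + 1) (by omega),
          hypergeometricCoeff_succ ha hb hb',
          show ((k + 1 : ℕ) : ℤ) + 1 = (k + 2 : ℕ) by omega, hu.init (k + 2) (by omega)]
        simp only [show k + 2 - 1 = k + 1 by omega]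
        ring

/-! ### Logarithmic derivatives of the hypergeometric functions -/

/-- The sequence generated by `q_{n+1} = q_n' + s q_n` satisfies the Leibniz recursion. -/
theorem leibniz_of_hasDerivAt {q : ℕ → ℝ → ℝ} {s : ℝ → ℝ} (hIo : IsOpen I)
    (hs : AnalyticOnNhd ℝ s I) (h0 : ∀ t ∈ I, q 0 t = 1)
    (hq : ∀ n, ∀ t ∈ I, HasDerivAt (q n) (q (n + 1) t - s t * q n t) t) (n : ℕ) {t : ℝ}
    (ht : t ∈ I) : q (n + 1) t =
      ∑ i ∈ range (n + 1), (n.choose i : ℝ) * (iteratedDeriv i s t * q (n - i) t) := by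
  induction n generalizing t with
  | zero =>
    have h1 : HasDerivAt (q 0) 0 t := (hasDerivAt_const t (1 : ℝ)).congr_of_eventuallyEq
      (eventually_of_mem (hIo.mem_nhds ht) h0)
    have := (hq 0 t ht).unique h1
    rw [h0 t ht] at this
    simp [h0 t ht]
    linarith
  | succ n ih =>
    have hds : ∀ i, HasDerivAt (iteratedDeriv i s) (iteratedDeriv (i + 1) s t) t := fun i => by
      have hA : AnalyticAt ℝ (iteratedDeriv i s) t := by
        rw [iteratedDeriv_eq_iterate]
        exact (hs t ht).iterated_deriv i
      rw [iteratedDeriv_succ]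
      exact hA.differentiableAt.hasDerivAt
    have h1 : HasDerivAt (q (n + 1)) (∑ i ∈ range (n + 1), (n.choose i : ℝ) *
        (iteratedDeriv (i + 1) s t * q (n - i) t + iteratedDeriv i s t *
          (q (n - i + 1) t - s t * q (n - i) t))) t := by
      refine HasDerivAt.congr_of_eventuallyEq ?_
        (eventually_of_mem (hIo.mem_nhds ht) fun x hx => ih hx)
      exact HasDerivAt.fun_sum fun i _ => ((hds i).mul (hq _ t ht)).const_mul _
    have h2 := (hq (n + 1) t ht).unique h1
    rw [sum_choose_succ_mul (fun i j => iteratedDeriv i s t * q j t)]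
    rw [eq_add_of_sub_eq h2, ih ht, mul_sum, ← sum_add_distrib, ← sum_add_distrib]
    refine sum_congr rfl fun i hi => ?_
    have hi : i ≤ n := by simpa [Nat.lt_succ_iff] using hi
    rw [Nat.sub_add_comm hi]
    ring

/-- The hypergeometric functions satisfy `f_j' / f_j = u_1 + ⋯ + u_j`. -/
theorem hasDerivAt_hypergeometricTau (hu : IsCauchySolution p a b c I u) (hIo : IsOpen I)
    (hI : IsPreconnected I) (h0 : (0 : ℝ) ∈ I)
    (ha : ∀ j : ℕ, a (j + p + 1) = a j + 1) (hb : ∀ j : ℕ, b (j + p) = b j + 1) (ha0 : a 0 = 0)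
    (hb' : ∀ j : ℕ, 0 < j → b j ≠ 0) {k : ℕ} (hk : k < p) {t : ℝ} (ht : t ∈ I) :
    HasDerivAt (hypergeometricTau p a b c (k + 1))
      (hypergeometricTau p a b c (k + 1) t * partialSum u (k + 1) t) t := by
  have h1 : a (p + 1) = 1 := by simpa [ha0] using ha 0
  obtain ⟨hF, hF0⟩ :=
    hypergeometricTau_analytic_and_iteratedDeriv (a := a) (b := b) (c := c) h1 hk
  have hS := analyticOnNhd_partialSum hu.toIsBLSolution (k + 1)
  -- For k < p both s_{k-p} and the weight at the negative height k - p - 1 vanish, so the Lax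
  -- equation becomes q_n' = q_{n+1} - s_{k+1} q_n.
  have hq : ∀ n, ∀ t ∈ I, HasDerivAt (pathWeight p u (k + (p + 1) * n) k)
      (pathWeight p u (k + (p + 1) * (n + 1)) k t -
        partialSum u (k + 1) t * pathWeight p u (k + (p + 1) * n) k t) t := by
    intro n t ht
    have := hasDerivAt_pathWeight hu ht (k + (p + 1) * n) k
    rw [partialSum_of_nonpos (by omega : (k : ℤ) - p ≤ 0),
      pathWeight_of_neg (fun j hj => hu.boundary j hj t ht) _ (by omega : (k : ℤ) - p - 1 < 0),
      sub_zero, sub_zero, add_assoc, add_assoc] at this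
    rwa [mul_add (p + 1), mul_one, mul_comm (partialSum u _ t)]
  have hq0 : ∀ t ∈ I, pathWeight p u (k + (p + 1) * 0) k t = 1 := fun t ht => by
    rw [mul_zero, add_zero, pathWeight_of_le (fun j hj => hu.boundary j hj t ht) hk.le,
      if_pos rfl]
  have hd : deriv (hypergeometricTau p a b c (k + 1)) t =
      hypergeometricTau p a b c (k + 1) t * partialSum u (k + 1) t := by
    refine eqOn_of_iteratedDeriv_eq (g := fun t =>
      hypergeometricTau p a b c (k + 1) t * partialSum u (k + 1) t) hI h0
      (fun x _ => (hF x).deriv) (fun x hx => (hF x).mul (hS x hx)) (fun n => ?_) ht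
    rw [← iteratedDeriv_succ', hF0, ← pathWeight_zero_right hu h0 ha hb ha0 hb',
      leibniz_of_hasDerivAt (q := fun n => pathWeight p u (k + (p + 1) * n) k) hIo hS hq0 hq n h0]
    simp only [mul_comm (hypergeometricTau p a b c (k + 1) _)]
    rw [iteratedDeriv_fun_mul (hS 0 h0).contDiffAt (hF 0).contDiffAt]
    refine sum_congr rfl fun i _ => ?_
    rw [hF0, ← pathWeight_zero_right hu h0 ha hb ha0 hb', mul_assoc]
  rw [← hd]
  exact (hF t).differentiableAt.hasDerivAt

/-! ### Construction of the functions f_j from a solution -/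

variable {f g : ℤ → ℝ → ℝ}

/-- The functions `f_n`, `n ≥ 0`, constructed from a solution `u` of the lattice. -/
noncomputable def tau (p : ℕ) (a b : ℕ → ℝ) (c : ℝ) (u : ℤ → ℝ → ℝ) (n : ℕ) : ℝ → ℝ :=
  if _h : p < n ∧ 0 < p then fun t =>
    u (n - p : ℕ) t * (tau p a b c u (n - p) t * tau p a b c u (n - p - 1) t) /
      tau p a b c u (n - p - p - 1) t
  else if n = 0 then fun _ => 1 else hypergeometricTau p a b c n
  termination_by n
  decreasing_by all_goals omega

theorem tau_zero : tau p a b c u 0 = fun _ => 1 := by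
  rw [tau]; simp

theorem tau_of_le {n : ℕ} (hn : 0 < n) (hnp : n ≤ p) :
    tau p a b c u n = hypergeometricTau p a b c n := by
  rw [tau, dif_neg (by omega), if_neg (by omega)]

/-- Truncated subtraction makes the denominator `tau` at index 0, the constant 1, whenever n ≤ p +
1, as f_{-p} = ⋯ = f_0 = 1 requires. A zero denominator gives the value 0, in agreement with the
degenerate convention. -/
theorem tau_add (hp : 1 ≤ p) {n : ℕ} (hn : 0 < n) (t : ℝ) : tau p a b c u (n + p) t =
    u n t * (tau p a b c u n t * tau p a b c u (n - 1) t) / tau p a b c u (n - p - 1) t := by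
  rw [tau, dif_pos (by omega)]
  simp only [Nat.add_sub_cancel]

theorem partialSum_toNat (j : ℤ) (t : ℝ) : partialSum u j.toNat t = partialSum u j t := by
  rw [partialSum, Int.toNat_natCast, partialSum]

theorem hasDerivAt_mul_mul_div {f₁ f₂ f₃ f₄ : ℝ → ℝ} {s₁ s₂ s₃ s₄ t : ℝ}
    (h₁ : HasDerivAt f₁ (f₁ t * s₁) t) (h₂ : HasDerivAt f₂ (f₂ t * s₂) t)
    (h₃ : HasDerivAt f₃ (f₃ t * s₃) t) (h₄ : HasDerivAt f₄ (f₄ t * s₄) t) (h : f₄ t ≠ 0) :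
    HasDerivAt (fun t => f₁ t * (f₂ t * f₃ t) / f₄ t)
      (f₁ t * (f₂ t * f₃ t) / f₄ t * (s₁ + s₂ + s₃ - s₄)) t := by
  convert! (h₁.mul (h₂.mul h₃)).div h₄ h using 1
  simp only [Pi.mul_apply]
  field_simp
  ring

section Solution

variable (hp : 1 ≤ p) (hu : IsCauchySolution p a b c I u) (hIo : IsOpen I) (hI : IsPreconnected I)
  (h0 : (0 : ℝ) ∈ I) (ha : ∀ j : ℕ, a (j + p + 1) = a j + 1) (hb : ∀ j : ℕ, b (j + p) = b j + 1)
  (ha0 : a 0 = 0) (hb' : ∀ j : ℕ, 0 < j → b j ≠ 0)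
include hp hu hIo hI h0 ha hb ha0 hb'

/-- The logarithmic derivative of u_j f_j f_{j-1} / f_{j-p-1} is the lattice factor plus s_j +
s_{j-1} - s_{j-p-1}, which is s_{j+p}. The dichotomy for f_{j-p-1} makes the quotient either
analytic or identically 0. -/
theorem tau_analytic_and_hasDerivAt (n : ℕ) : AnalyticOnNhd ℝ (tau p a b c u n) I ∧
    ∀ t ∈ I, HasDerivAt (tau p a b c u n) (tau p a b c u n t * partialSum u n t) t := by
  induction n using Nat.strong_induction_on with
  | _ n ih =>
    rcases Nat.eq_zero_or_pos n with rfl | hn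
    · rw [tau_zero]
      refine ⟨fun _ _ => analyticAt_const, fun t _ => ?_⟩
      convert! hasDerivAt_const t (1 : ℝ) using 1
      simp [partialSum]
    rcases le_or_gt n p with hnp | hnp
    · rw [tau_of_le hn hnp]
      obtain ⟨k, rfl⟩ : ∃ k, n = k + 1 := ⟨n - 1, by omega⟩
      refine ⟨fun t _ => (hypergeometricTau_analytic_and_iteratedDeriv
        (by simpa [ha0] using ha 0) hnp).1 t, fun t ht => ?_⟩
      exact_mod_cast hasDerivAt_hypergeometricTau hu hIo hI h0 ha hb ha0 hb' hnp ht
    · obtain ⟨j, hj, rfl⟩ : ∃ j, 0 < j ∧ n = j + p := ⟨n - p, by omega, by omega⟩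
      obtain ⟨hA1, hD1⟩ := ih j (by omega)
      obtain ⟨hA2, hD2⟩ := ih (j - 1) (by omega)
      obtain ⟨hA3, hD3⟩ := ih (j - p - 1) (by omega)
      have e : tau p a b c u (j + p) = fun t => u j t *
        (tau p a b c u j t * tau p a b c u (j - 1) t) / tau p a b c u (j - p - 1) t :=
        funext fun t => tau_add hp hj t
      rcases eq_zero_or_ne_zero_of_hasDerivAt hI hIo hA3
        (analyticOnNhd_partialSum hu.toIsBLSolution _) hD3 with h | h
      · have hz : ∀ t ∈ I, tau p a b c u (j + p) =ᶠ[𝓝 t] fun _ => 0 := fun t ht => by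
          filter_upwards [hIo.mem_nhds ht] with x hx
          rw [e]
          simp [h x hx]
        refine ⟨fun t ht => analyticAt_const.congr (hz t ht).symm, fun t ht => ?_⟩
        rw [(hz t ht).eq_of_nhds, zero_mul]
        exact (hasDerivAt_const t (0 : ℝ)).congr_of_eventuallyEq (hz t ht)
      · rw [e]
        refine ⟨((hu.analytic j).mul (hA1.mul hA2)).div hA3 h, fun t ht => ?_⟩
        convert! hasDerivAt_mul_mul_div (hu.hasDerivAt j ht) (hD1 t ht) (hD2 t ht) (hD3 t ht)
          (h t ht) using 2
        rw [← partialSum_toNat ((j : ℤ) - p - 1), show ((j : ℤ) - p - 1).toNat = j - p - 1 by omega,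
          show (j : ℤ) - 1 = (j - 1 : ℕ) by omega]
        push_cast
        ring

theorem tau_eq_zero_or_ne_zero (n : ℕ) :
    (∀ t ∈ I, tau p a b c u n t = 0) ∨ ∀ t ∈ I, tau p a b c u n t ≠ 0 := by
  obtain ⟨hA, hD⟩ := tau_analytic_and_hasDerivAt hp hu hIo hI h0 ha hb ha0 hb' n
  exact eq_zero_or_ne_zero_of_hasDerivAt hI hIo hA
    (analyticOnNhd_partialSum hu.toIsBLSolution _) hD

theorem isTauSequence_tau : IsTauSequence p a b c I fun j => tau p a b c u j.toNat := by
  have hspec := tau_analytic_and_hasDerivAt hp hu hIo hI h0 ha hb ha0 hb'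
  refine ⟨fun j _ => (hspec _).1, fun j _ hj t _ => ?_, fun j hj hjp t _ => ?_,
    fun j hj t ht => ?_, fun j hj h t ht => ?_⟩
  · simp [Int.toNat_of_nonpos hj, tau_zero]
  · simp [tau_of_le hj hjp, hypergeometricTau]
  all_goals
    obtain ⟨n, hn, rfl⟩ : ∃ n : ℕ, 0 < n ∧ j = n := ⟨j.toNat, by omega, by omega⟩
    simp only [Int.toNat_natCast, show ((n : ℤ) - 1).toNat = n - 1 by omega,
      show ((n : ℤ) - p - 1).toNat = n - p - 1 by omega,
      show ((n : ℤ) + p).toNat = n + p by omega] at *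
  · have e := partialSum_eq_add (u := u) (fun k hk => hu.boundary k hk t ht) n
    rw [show (n : ℤ) - 1 = (n - 1 : ℕ) by omega] at e
    rw [((hspec _).2 t ht).deriv, ((hspec _).2 t ht).deriv, e, tau_add hp hn]
    rcases tau_eq_zero_or_ne_zero hp hu hIo hI h0 ha hb ha0 hb' (n - p - 1) with h | h
    · have hz : tau p a b c u (n - 1) t = 0 := by
        have hlt : 0 < n - p - 1 := by
          by_contra hcon
          have := h t ht
          rw [show n - p - 1 = 0 by omega, tau_zero] at this
          exact one_ne_zero this
        rw [show n - 1 = n - p - 1 + p by omega, tau_add hp hlt, h t ht]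
        simp
      rw [h t ht, hz]
      simp
    · have := h t ht
      field_simp
      ring
  · rw [tau_add hp hn, h t ht, div_zero]

/-- By the dichotomy the value at 0 decides. It is built from earlier nonzero values and u_j(0),
which can vanish only when a_{j-1} = b_{j-1}. -/
theorem tau_ne_zero (hne : ∀ j : ℕ, 0 < j → u j 0 ≠ 0 ∨ ∃ i, 1 ≤ i ∧ j = i + 1 ∧ a i = b i)
    (n : ℕ) (h : ∀ i : ℕ, 1 ≤ i → i + p < n → a i ≠ b i) : ∀ t ∈ I, tau p a b c u n t ≠ 0 := by
  have hspec := tau_analytic_and_hasDerivAt hp hu hIo hI h0 ha hb ha0 hb'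
  suffices hz : tau p a b c u n 0 ≠ 0 from
    (tau_eq_zero_or_ne_zero hp hu hIo hI h0 ha hb ha0 hb' n).resolve_left fun h => hz (h 0 h0)
  induction n using Nat.strong_induction_on with
  | _ n ih =>
    rcases Nat.eq_zero_or_pos n with rfl | hn
    · simp [tau_zero]
    rcases le_or_gt n p with hnp | hnp
    · obtain ⟨k, rfl⟩ : ∃ k, n = k + 1 := ⟨n - 1, by omega⟩
      rw [tau_of_le hn hnp, hypergeometricTau_zero (by simpa [ha0] using ha 0) hnp]
      exact one_ne_zero
    · obtain ⟨j, hj, rfl⟩ : ∃ j, 0 < j ∧ n = j + p := ⟨n - p, by omega, by omega⟩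
      have ih' : ∀ m < j + p, tau p a b c u m 0 ≠ 0 := fun m hm =>
        ih m hm fun i hi him => h i hi (by omega)
      rw [tau_add hp hj]
      refine div_ne_zero (mul_ne_zero ?_ (mul_ne_zero (ih' _ (by omega)) (ih' _ (by omega))))
        (ih' _ (by omega))
      rcases hne j hj with h1 | ⟨i, hi, rfl, hab⟩
      · exact h1
      · exact absurd hab (h i hi (by omega))

end Solution

/-! ### Uniqueness of the functions f_j and restriction to subintervals -/

theorem initialData_ne_zero (hc : c ≠ 0) (ha' : ∀ j : ℕ, 0 < j → a j ≠ 0)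
    (hb' : ∀ j : ℕ, 0 < j → b j ≠ 0) {j : ℕ} (hj : 0 < j) :
    initialData p a b c j ≠ 0 ∨ ∃ i, 1 ≤ i ∧ j = i + 1 ∧ a i = b i := by
  have hprod : ∀ {x : ℕ → ℝ}, (∀ j, 0 < j → x j ≠ 0) → ∀ {m n : ℕ}, 0 < m →
      ∏ i ∈ Ico m n, x i ≠ 0 := fun hx m n hm =>
    prod_ne_zero_iff.2 fun i hi => hx i (hm.trans_le (mem_Ico.1 hi).1)
  rcases eq_or_ne j 1 with rfl | hj1
  · left
    simp only [initialData, Nat.cast_one, if_neg (by omega : ¬(1 : ℤ) ≤ 0), if_true]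
    exact mul_ne_zero (pow_ne_zero _ hc)
      (div_ne_zero (hprod ha' one_pos) (hprod hb' one_pos))
  · obtain ⟨i, rfl⟩ : ∃ i, j = i + 1 := ⟨j - 1, by omega⟩
    rcases eq_or_ne (a i) (b i) with h | h
    · exact Or.inr ⟨i, by omega, rfl, h⟩
    · left
      rw [initialData, if_neg (by omega), if_neg (by omega), Int.toNat_natCast, Nat.add_sub_cancel]
      exact mul_ne_zero (pow_ne_zero _ hc) (div_ne_zero
        (mul_ne_zero (sub_ne_zero.2 h.symm) (hprod ha' hj)) (hprod hb' (by omega)))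

/-- By (1), f_{m-p-1} times the difference of the two candidates for f_{m+p} is 0. Analytic
functions on a connected set have no zero divisors, so the candidates agree or f_{m-p-1} ≡ 0, and
then the degenerate convention makes both 0. -/
theorem IsTauSequence.eqOn (hp : 1 ≤ p) (hf : IsTauSequence p a b c I f) (hg : IsTauSequence p a b c I g)
    (hIo : IsOpen I) (hI : IsPreconnected I) {j : ℤ} (hj : -(p : ℤ) ≤ j) :
    Set.EqOn (f j) (g j) I := by
  suffices h : ∀ n : ℕ, ∀ j : ℤ, -(p : ℤ) ≤ j → j < n → Set.EqOn (f j) (g j) I from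
    h (j.toNat + 1) j hj (by omega)
  intro n
  induction n with
  | zero =>
    intro j hj hj0 t ht
    rw [hf.eq_one j hj (by omega) t ht, hg.eq_one j hj (by omega) t ht]
  | succ n ih =>
    intro j hj hjn t ht
    rcases le_or_gt j 0 with hj0 | hj0
    · rw [hf.eq_one j hj hj0 t ht, hg.eq_one j hj hj0 t ht]
    rcases le_or_gt j p with hjp | hjp
    · lift j to ℕ using hj0.le
      rw [hf.hypergeometric j (by omega) (by omega) t ht,
        hg.hypergeometric j (by omega) (by omega) t ht]
    · obtain ⟨m, hm, rfl⟩ : ∃ m : ℤ, 1 ≤ m ∧ j = m + p := ⟨j - p, by omega, by omega⟩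
      have e1 := ih m (by omega) (by omega)
      have e2 := ih (m - 1) (by omega) (by omega)
      have e3 := ih (m - p - 1) (by omega) (by omega)
      have key : ∀ x ∈ I, f (m - p - 1) x * (f (m + p) - g (m + p)) x = 0 := fun x hx => by
        have d1 := (e1.eventuallyEq_of_mem (hIo.mem_nhds hx)).deriv_eq
        have d2 := (e2.eventuallyEq_of_mem (hIo.mem_nhds hx)).deriv_eq
        have b1 := hf.bilinear m hm x hx
        have b2 := hg.bilinear m hm x hx
        rw [← e1 hx, ← e2 hx, ← e3 hx, ← d1, ← d2] at b2
        rw [Pi.sub_apply]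
        linear_combination b2 - b1
      rcases (hf.analytic _ (by omega)).eq_zero_or_eq_zero_of_mul_eq_zero
        ((hf.analytic (m + p) hj).sub (hg.analytic (m + p) hj)) key hI with h | h
      · rw [hf.degenerate m hm h t ht, hg.degenerate m hm (fun x hx => by rw [← e3 hx, h x hx]) t ht]
      · exact sub_eq_zero.1 (h t ht)

/-- Only the degenerate clause needs an argument: vanishing on the smaller set spreads to I by the
identity theorem. -/
theorem IsTauSequence.mono {J : Set ℝ} (hf : IsTauSequence p a b c I f) (hJI : J ⊆ I)
    (hI : IsPreconnected I) (hJ : IsOpen J) {x : ℝ} (hx : x ∈ J) : IsTauSequence p a b c J f where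
  analytic j hj := (hf.analytic j hj).mono hJI
  eq_one j hj hj0 t ht := hf.eq_one j hj hj0 t (hJI ht)
  hypergeometric j hj hjp t ht := hf.hypergeometric j hj hjp t (hJI ht)
  bilinear j hj t ht := hf.bilinear j hj t (hJI ht)
  degenerate j hj h t ht := hf.degenerate j hj
    (fun y hy => (hf.analytic _ (by omega)).eqOn_zero_of_preconnected_of_eventuallyEq_zero hI
      (hJI hx) (eventually_of_mem (hJ.mem_nhds hx) h) hy) t (hJI ht)

theorem IsCauchySolution.mono {J : Set ℝ} (hu : IsCauchySolution p a b c I u) (hJI : J ⊆ I) :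
    IsCauchySolution p a b c J u where
  analytic j := (hu.analytic j).mono hJI
  lattice j t ht := hu.lattice j t (hJI ht)
  boundary j hj t ht := hu.boundary j hj t (hJI ht)
  init_one := hu.init_one
  init := hu.init

/-! ### From the functions f_j to the lattice -/

/-- The solution of the Cauchy problem in terms of the functions `f_j`. -/
theorem IsCauchySolution.eq_logDeriv_sub (hp : 1 ≤ p) (hu : IsCauchySolution p a b c I u)
    (hIo : IsOpen I) (hI : IsPreconnected I) (h0 : (0 : ℝ) ∈ I)
    (ha : ∀ j : ℕ, a (j + p + 1) = a j + 1) (hb : ∀ j : ℕ, b (j + p) = b j + 1) (ha0 : a 0 = 0)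
    (hb' : ∀ j : ℕ, 0 < j → b j ≠ 0) (hf : IsTauSequence p a b c I f) {j : ℤ} (hj : 1 ≤ j)
    (h1 : ∃ t ∈ I, f (j - 1) t ≠ 0) (h2 : ∃ t ∈ I, f j t ≠ 0) {t : ℝ} (ht : t ∈ I) :
    f (j - 1) t ≠ 0 ∧ f j t ≠ 0 ∧
      u j t = deriv (f j) t / f j t - deriv (f (j - 1)) t / f (j - 1) t := by
  have heq := fun (k : ℤ) (hk : -(p : ℤ) ≤ k) =>
    hf.eqOn hp (isTauSequence_tau hp hu hIo hI h0 ha hb ha0 hb') hIo hI hk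
  have hspec := tau_analytic_and_hasDerivAt hp hu hIo hI h0 ha hb ha0 hb'
  have hne : ∀ k : ℤ, -(p : ℤ) ≤ k → (∃ t ∈ I, f k t ≠ 0) → f k t ≠ 0 ∧
      deriv (f k) t / f k t = partialSum u k t := by
    rintro k hk ⟨x, hx, hfx⟩
    rw [((heq k hk).eventuallyEq_of_mem (hIo.mem_nhds ht)).deriv_eq, ((hspec _).2 t ht).deriv,
      heq k hk ht, partialSum_toNat]
    rw [heq k hk hx] at hfx
    have := (tau_eq_zero_or_ne_zero hp hu hIo hI h0 ha hb ha0 hb' k.toNat).resolve_left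
      (fun h => hfx (h x hx)) t ht
    exact ⟨this, mul_div_cancel_left₀ _ this⟩
  obtain ⟨n1, d1⟩ := hne (j - 1) (by omega) h1
  obtain ⟨n2, d2⟩ := hne j (by omega) h2
  refine ⟨n1, n2, ?_⟩
  rw [d1, d2, partialSum_eq_add (fun k hk => hu.boundary k hk t ht) j]
  ring

/-- Nowhere vanishing functions `f_j` define a solution of the lattice. -/
theorem IsTauSequence.isBLSolution (hf : IsTauSequence p a b c I f) (hIo : IsOpen I)
    (hne : ∀ j : ℤ, 1 ≤ j → ∀ t ∈ I, f j t ≠ 0) (hu0 : ∀ j : ℤ, j ≤ 0 → u j = 0)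
    (hu : ∀ j : ℤ, 1 ≤ j → u j = fun t =>
      deriv (f j) t / f j t - deriv (f (j - 1)) t / f (j - 1) t) : IsBLSolution p I u := by
  have hne' : ∀ j : ℤ, -(p : ℤ) ≤ j → ∀ t ∈ I, f j t ≠ 0 := fun j hj t ht => by
    rcases le_or_gt j 0 with h | h
    · rw [hf.eq_one j hj h t ht]; exact one_ne_zero
    · exact hne j h t ht
  -- The cut-off at j ≤ 0 is needed because f_j is unconstrained for j < -p, while the telescoping
  -- uses s_j for every integer j.
  set s : ℤ → ℝ → ℝ := fun j t => if j ≤ 0 then 0 else deriv (f j) t / f j t with hs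
  have hd : ∀ j : ℤ, -(p : ℤ) ≤ j → ∀ t ∈ I, HasDerivAt (f j) (f j t * s j t) t :=
    fun j hj t ht => by
      rcases le_or_gt j 0 with h | h
      · simp only [hs, if_pos h, mul_zero]
        exact (hasDerivAt_const t (1 : ℝ)).congr_of_eventuallyEq
          (eventually_of_mem (hIo.mem_nhds ht) fun x hx => hf.eq_one j hj h x hx)
      · simp only [hs, if_neg (by omega : ¬j ≤ 0)]
        rw [mul_div_cancel₀ _ (hne j h t ht)]
        exact (hf.analytic j hj t ht).differentiableAt.hasDerivAt
  have hus : ∀ j : ℤ, ∀ t ∈ I, s j t = s (j - 1) t + u j t := fun j t ht => by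
    rcases le_or_gt j 0 with h | h
    · simp [hs, hu0 j h, h, (by omega : j ≤ 1)]
    · have h' : -(p : ℤ) ≤ j - 1 := by omega
      have e1 : s j t = deriv (f j) t / f j t := if_neg (by omega)
      have e2 : s (j - 1) t = deriv (f (j - 1)) t / f (j - 1) t := by
        rw [(hd (j - 1) h' t ht).deriv, mul_div_cancel_left₀ _ (hne' (j - 1) h' t ht)]
      rw [hu j h, e1, e2]
      ring
  refine ⟨fun j => ?_, fun j t ht => ?_⟩
  · rcases le_or_gt j 0 with h | h
    · rw [hu0 j h]; exact fun _ _ => analyticAt_const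
    · rw [hu j h]
      have hA := fun (k : ℤ) (hk : -(p : ℤ) ≤ k) => hf.analytic k hk
      exact ((hA j (by omega)).deriv.div (hA j (by omega)) (hne' j (by omega))).sub
        ((hA (j - 1) (by omega)).deriv.div (hA (j - 1) (by omega)) (hne' (j - 1) (by omega)))
  · change HasDerivAt (u j) (u j t * latticeFactor p (fun k => u k t) j) t
    rcases le_or_gt j 0 with h | h
    · simp only [hu0 j h, Pi.zero_apply, zero_mul]
      exact hasDerivAt_const t (0 : ℝ)
    -- Equation (1) gives u_j = f_{j-p-1} f_{j+p} / (f_{j-1} f_j), whose logarithmic derivative is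
    -- the telescoped lattice factor. The factor 1 only fits the shape of `hasDerivAt_mul_mul_div`.
    · have hform : ∀ x ∈ I, u j x = 1 * (f (j - p - 1) x * f (j + p) x) / (f (j - 1) x * f j x) :=
        fun x hx => by
          have n1 := hne' (j - 1) (by omega) x hx
          have n2 := hne' j (by omega) x hx
          rw [one_mul, ← hf.bilinear j h x hx, hu j h]
          field_simp
      have hprod : HasDerivAt (fun x => f (j - 1) x * f j x)
          ((f (j - 1) t * f j t) * (s (j - 1) t + s j t)) t := by
        convert! (hd (j - 1) (by omega) t ht).mul (hd j (by omega) t ht) using 1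
        ring
      have hone : HasDerivAt (fun _ : ℝ => (1 : ℝ)) (1 * 0) t := by
        simpa using hasDerivAt_const t (1 : ℝ)
      have := (hasDerivAt_mul_mul_div hone (hd (j - p - 1) (by omega) t ht)
        (hd (j + p) (by omega) t ht) hprod
        (mul_ne_zero (hne' (j - 1) (by omega) t ht) (hne' j (by omega) t ht))).congr_of_eventuallyEq
        (eventually_of_mem (hIo.mem_nhds ht) hform)
      convert! this using 1
      rw [hform t ht, latticeFactor_eq_of_telescope (v := fun k => u k t) (s := fun k => s k t)
        fun k => hus k t ht]
      ring

end Bogoyavlensky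

theorem theorem1 (p : ℕ) (hp : 1 ≤ p) (a b : ℕ → ℝ) (c : ℝ)
    (ha : ∀ j : ℕ, a (j + p + 1) = a j + 1) (hb : ∀ j : ℕ, b (j + p) = b j + 1)
    (ha0 : a 0 = 0) (hc : c ≠ 0)
    (ha' : ∀ j : ℕ, 0 < j → a j ≠ 0) (hb' : ∀ j : ℕ, 0 < j → b j ≠ 0) :
    -- the Cauchy problem has a solution on a neighbourhood of `0` common to all components
    (∃ δ : ℝ, 0 < δ ∧ ∃ u : ℤ → ℝ → ℝ, IsCauchySolution p a b c (Set.Ioo (-δ) δ) u) ∧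
    -- on every open interval containing `0`
    ∀ I : Set ℝ, IsOpen I → I.OrdConnected → (0 : ℝ) ∈ I →
      -- the solution and the functions `f_j` are unique
      (∀ u w : ℤ → ℝ → ℝ, IsCauchySolution p a b c I u → IsCauchySolution p a b c I w →
        ∀ j : ℤ, ∀ t ∈ I, u j t = w j t) ∧
      (∀ f g : ℤ → ℝ → ℝ, IsTauSequence p a b c I f → IsTauSequence p a b c I g →
        ∀ j : ℤ, -(p : ℤ) ≤ j → ∀ t ∈ I, f j t = g j t) ∧
      -- where the solution is defined, it is given by the functions `f_j`
      (∀ u : ℤ → ℝ → ℝ, IsCauchySolution p a b c I u →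
        (∃ f : ℤ → ℝ → ℝ, IsTauSequence p a b c I f) ∧
        ∀ f : ℤ → ℝ → ℝ, IsTauSequence p a b c I f →
          (∀ j : ℤ, 1 ≤ j → (∃ t ∈ I, f (j - 1) t ≠ 0) → (∃ t ∈ I, f j t ≠ 0) →
            ∀ t ∈ I, f (j - 1) t ≠ 0 ∧ f j t ≠ 0 ∧
              u j t = deriv (f j) t / f j t - deriv (f (j - 1)) t / f (j - 1) t) ∧
          (∀ j : ℤ, 1 ≤ j → (∀ i : ℕ, 1 ≤ i → (i : ℤ) + p < j → a i ≠ b i) →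
            ∀ t ∈ I, f j t ≠ 0)) ∧
      -- where the functions `f_j` do not vanish, they give the solution
      (∀ f : ℤ → ℝ → ℝ, IsTauSequence p a b c I f →
        (∀ j : ℤ, 1 ≤ j → ∀ t ∈ I, f j t ≠ 0) →
        ∀ u : ℤ → ℝ → ℝ, (∀ j : ℤ, j ≤ 0 → u j = 0) →
          (∀ j : ℤ, 1 ≤ j → u j = fun t =>
            deriv (f j) t / f j t - deriv (f (j - 1)) t / f (j - 1) t) →
          IsCauchySolution p a b c I u) := by
  refine ⟨exists_isCauchySolution hp ha hb hb', fun I hIo hI h0 => ?_⟩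
  have hI := hI.isPreconnected
  refine ⟨fun u w hu hw j => hu.eqOn hw hIo hI h0 j,
    fun f g hf hg j hj => hf.eqOn hp hg hIo hI hj, fun u hu => ?_, fun f hf hne u hu0 hu => ?_⟩
  · have htau := isTauSequence_tau hp hu hIo hI h0 ha hb ha0 hb'
    refine ⟨⟨_, htau⟩, fun f hf => ⟨fun j hj h1 h2 t ht =>
      hu.eq_logDeriv_sub hp hIo hI h0 ha hb ha0 hb' hf hj h1 h2 ht, fun j hj h t ht => ?_⟩⟩
    rw [hf.eqOn hp htau hIo hI (by omega) ht]
    refine tau_ne_zero hp hu hIo hI h0 ha hb ha0 hb' (fun k hk => ?_) j.toNat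
      (fun i hi hij => h i hi (by omega)) t ht
    rw [hu.apply_zero h0]
    exact initialData_ne_zero hc ha' hb' hk
  · have hBL := hf.isBLSolution hIo hne hu0 hu
    -- The initial data are not computed from the f_j. The local solution v is given by the same f_j
    -- on a smaller interval, so u and v agree at 0.
    obtain ⟨δ, hδ, v, hv⟩ := exists_isCauchySolution (c := c) hp ha hb hb'
    have hJo : IsOpen (I ∩ Set.Ioo (-δ) δ) := hIo.inter isOpen_Ioo
    have hJ : IsPreconnected (I ∩ Set.Ioo (-δ) δ) :=
      (hI.ordConnected.inter Set.ordConnected_Ioo).isPreconnected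
    have h0J : (0 : ℝ) ∈ I ∩ Set.Ioo (-δ) δ := ⟨h0, by simpa using hδ⟩
    have hfJ := hf.mono Set.inter_subset_left hI hJo h0J
    have hvJ := hv.mono (J := I ∩ Set.Ioo (-δ) δ) Set.inter_subset_right
    refine isCauchySolution_of_apply_zero hBL (fun j hj t _ => by rw [hu0 j hj]; rfl) fun j => ?_
    rw [← hvJ.apply_zero h0J]
    rcases le_or_gt j 0 with hj | hj
    · rw [hu0 j hj, hvJ.boundary j hj 0 h0J]
      rfl
    · have hprev : f (j - 1) 0 ≠ 0 := by
        rcases eq_or_ne j 1 with rfl | hj1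
        · rw [sub_self, hf.eq_one 0 (by omega) le_rfl 0 h0]
          exact one_ne_zero
        · exact hne (j - 1) (by omega) 0 h0
      rw [hu j hj, (hvJ.eq_logDeriv_sub hp hJo hJ h0J ha hb ha0 hb' hfJ hj ⟨0, h0J, hprev⟩
        ⟨0, h0J, hne j hj 0 h0⟩ h0J).2.2]
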